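/- Let $\Bbbk$ be a field, let $I\subseteq \Bbbk[x]=\Bbbk[x_1,\dots,x_n]$ be a binomial ideal (an ideal generated by polynomials with at most two terms), and let $\Delta\subseteq\{1,\dots,n\}$. Suppose that $I$ is $\Delta$-cellular: every variable is either a nonzerodivisor or nilpotent modulo $I$, and $\Delta$ is the set of indices of the variables that are nonzerodivisors modulo $I$. Write $\Bbbk[\mathbb N^\Delta]=\Bbbk[x_i\mid i\in\Delta]$ and $\Delta^c=\{1,\dots,n\}\setminus\Delta$. A partial character on $\mathbb Z^\Delta$ is a pair $(L_\tau,\tau)$ of a subgroup $L_\tau\subseteq\mathbb Z^\Delta$ and a group homomorphism $\tau:L_\tau\to\Bbbk^*$; its lattice ideal is $I(\tau)=\langle x^u-\tau(u-v)x^v \mid u,v\in\mathbb N^\Delta,\ u-v\in L_\tau\rangle\subseteq\Bbbk[\mathbb N^\Delta]$. If $I$ is proper, let $(L_\rho,\rho)$ be the partial character on $\mathbb Z^\Delta$ with $I\cap\Bbbk[\mathbb N^\Delta]=I(\rho)$. A lattice $L\subseteq\mathbb Z^\Delta$ is associated to $I$ if there are a monomial $m\in\Bbbk[x_i\mid i\in\Delta^c]$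 (a witness monomial of $L$) and a partial character $\tau:L\to\Bbbk^*$ with $(I:m)\cap\Bbbk[\mathbb N^\Delta]=I(\tau)$, and it is embedded if moreover $\operatorname{rank} L>\operatorname{rank} L_\rho$. Let $M_{\mathrm{emb}}(I)\subseteq\Bbbk[x]$ be the ideal generated by the witness monomials of all embedded associated lattices of $I$ (so $M_{\mathrm{emb}}(I)=0$ if there are none, and in particular if $I=\Bbbk[x]$). The minimal embedded lattice ideals of $I$ are the inclusion-minimal elements of the set of all lattice ideals $I(\tau)=(I:m)\cap\Bbbk[\mathbb N^\Delta]$, where $m\in\Bbbk[x_i\mid i\in\Delta^c]$ is a monomial and $L_\tau$ is an embedded associated lattice of $I$. Then $I$ has only finitely many minimal embedded lattice ideals $I(\tau_1),\dots,I(\tau_k)$ (possibly $k=0$), and \[ I=\bigl(I+M_{\mathrm{emb}}(I)\bigr)\cap\bigcap_{j=1}^k\Bigl(\bigl(I+\Bbbk[x]\cdot I(\tau_j)\bigr):\bigl(\textstyle\prod_{i\in\Delta}x_i\bigr)^\infty\Bigr), \] where $(J:f^\infty)=\{g\in\Bbbk[x]\mid g f^N\in J\text{ for some }N\ge 0\}$,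 and an empty intersection is $\Bbbk[x]$. -/

import Mathlib

open MvPolynomial

/-- An ideal of a polynomial ring is binomial if it is generated by polynomials with at most
two terms. -/
def IsBinomialIdeal {k σ : Type*} [Field k] (I : Ideal (MvPolynomial σ k)) : Prop :=
  ∃ S : Set (MvPolynomial σ k), (∀ f ∈ S, f.support.card ≤ 2) ∧ I = Ideal.span S

/-- `I` is `Δ`-cellular: every variable is a nonzerodivisor or nilpotent modulo `I`, and `Δ` is
the set of indices of the nonzerodivisor variables. -/
def IsCellular {k : Type*} [Field k] {n : ℕ} (Δ : Finset (Fin n))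
    (I : Ideal (MvPolynomial (Fin n) k)) : Prop :=
  (∀ i : Fin n,
    Ideal.Quotient.mk I (X i) ∈ nonZeroDivisors (MvPolynomial (Fin n) k ⧸ I) ∨
      IsNilpotent (Ideal.Quotient.mk I (X i))) ∧
  ∀ i : Fin n,
    i ∈ Δ ↔ Ideal.Quotient.mk I (X i) ∈ nonZeroDivisors (MvPolynomial (Fin n) k ⧸ I)

/-- A partial character on `ℤ^ι`: a subgroup `L` of `ℤ^ι` with a group homomorphism
`L → kˣ`. -/
structure PartialCharacter (k ι : Type*) [Field k] where
  lattice : AddSubgroup (ι → ℤ)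
  char : Multiplicative lattice →* kˣ

/-- The rank of the lattice of a partial character. -/
noncomputable def PartialCharacter.rank {k ι : Type*} [Field k] (ρ : PartialCharacter k ι) : ℕ :=
  Module.finrank ℤ ρ.lattice

/-- The difference `u - v ∈ ℤ^ι` of two exponent vectors. -/
def expDiff {ι : Type*} (u v : ι →₀ ℕ) : ι → ℤ := fun i => (u i : ℤ) - (v i : ℤ)

/-- The lattice ideal `I(ρ) = ⟨x^u - ρ(u - v) x^v : u - v ∈ L_ρ⟩`. -/
noncomputable def PartialCharacter.latticeIdeal {k ι : Type*} [Field k]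
    (ρ : PartialCharacter k ι) : Ideal (MvPolynomial ι k) :=
  Ideal.span {f | ∃ (u v : ι →₀ ℕ) (h : expDiff u v ∈ ρ.lattice),
    f = monomial u 1 - monomial v (ρ.char (Multiplicative.ofAdd ⟨expDiff u v, h⟩) : k)}

/-- The inclusion `k[ℕ^Δ] = k[x_i : i ∈ Δ] → k[x_1, …, x_n]`. -/
noncomputable def inclPoly (k : Type*) [Field k] {n : ℕ} (Δ : Finset (Fin n)) :
    MvPolynomial {i // i ∈ Δ} k →ₐ[k] MvPolynomial (Fin n) k :=
  rename (fun i : {i // i ∈ Δ} => (i : Fin n))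

/-- The elimination ideal `J ∩ k[ℕ^Δ]`. -/
noncomputable def elimIdeal {k : Type*} [Field k] {n : ℕ} (Δ : Finset (Fin n))
    (J : Ideal (MvPolynomial (Fin n) k)) : Ideal (MvPolynomial {i // i ∈ Δ} k) :=
  J.comap (inclPoly k Δ)

/-- The saturation `(J : f^∞) = {g : g f^N ∈ J for some N}`. -/
def idealSaturation {R : Type*} [CommRing R] (J : Ideal R) (f : R) : Ideal R where
  carrier := {g | ∃ N : ℕ, g * f ^ N ∈ J}
  add_mem' := by
    rintro a b ⟨N, hN⟩ ⟨M, hM⟩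
    refine ⟨N + M, ?_⟩
    have h : (a + b) * f ^ (N + M) = f ^ M * (a * f ^ N) + f ^ N * (b * f ^ M) := by ring
    rw [h]
    exact J.add_mem (J.mul_mem_left _ hN) (J.mul_mem_left _ hM)
  zero_mem' := ⟨0, by simp⟩
  smul_mem' := by
    rintro c a ⟨N, hN⟩
    refine ⟨N, ?_⟩
    rw [smul_eq_mul, mul_assoc]
    exact J.mul_mem_left c hN

/-- The monomial `x^a` lies in `k[ℕ^{Δᶜ}]` and witnesses that the lattice of `τ` is associated
to `I`, namely `(I : x^a) ∩ k[ℕ^Δ] = I(τ)`. -/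
def IsWitness {k : Type*} [Field k] {n : ℕ} (Δ : Finset (Fin n))
    (I : Ideal (MvPolynomial (Fin n) k)) (a : Fin n →₀ ℕ)
    (τ : PartialCharacter k {i // i ∈ Δ}) : Prop :=
  (∀ i ∈ Δ, a i = 0) ∧ elimIdeal Δ (Submodule.colon I {monomial a (1 : k)}) = τ.latticeIdeal

/-- `x^a` witnesses that the lattice of `τ` is an embedded associated lattice of `I`: its rank
exceeds the rank of `L_ρ`, where `I ∩ k[ℕ^Δ] = I(ρ)`. -/
def IsEmbeddedWitness {k : Type*} [Field k] {n : ℕ} (Δ : Finset (Fin n))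
    (I : Ideal (MvPolynomial (Fin n) k)) (a : Fin n →₀ ℕ)
    (τ : PartialCharacter k {i // i ∈ Δ}) : Prop :=
  IsWitness Δ I a τ ∧
    ∃ ρ : PartialCharacter k {i // i ∈ Δ}, elimIdeal Δ I = ρ.latticeIdeal ∧ ρ.rank < τ.rank

/-- The ideal `M_emb(I)` generated by the witness monomials of the embedded associated
lattices. -/
noncomputable def embeddedMonomialIdeal {k : Type*} [Field k] {n : ℕ} (Δ : Finset (Fin n))
    (I : Ideal (MvPolynomial (Fin n) k)) : Ideal (MvPolynomial (Fin n) k) :=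
  Ideal.span {f | ∃ (a : Fin n →₀ ℕ) (τ : PartialCharacter k {i // i ∈ Δ}),
    IsEmbeddedWitness Δ I a τ ∧ f = monomial a 1}

/-- The lattice ideals `I(τ) = (I : m) ∩ k[ℕ^Δ]` of the embedded associated lattices of `I`. -/
def embeddedLatticeIdeals {k : Type*} [Field k] {n : ℕ} (Δ : Finset (Fin n))
    (I : Ideal (MvPolynomial (Fin n) k)) : Set (Ideal (MvPolynomial {i // i ∈ Δ} k)) :=
  {J | ∃ (a : Fin n →₀ ℕ) (τ : PartialCharacter k {i // i ∈ Δ}),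
    IsEmbeddedWitness Δ I a τ ∧ J = τ.latticeIdeal}

/-- The minimal embedded lattice ideals of `I`. -/
def minimalEmbeddedLatticeIdeals {k : Type*} [Field k] {n : ℕ} (Δ : Finset (Fin n))
    (I : Ideal (MvPolynomial (Fin n) k)) : Set (Ideal (MvPolynomial {i // i ∈ Δ} k)) :=
  {J | Minimal (fun J' => J' ∈ embeddedLatticeIdeals Δ I) J}

/-! Only the inclusion of the intersection in `I` needs work. Call two exponents equivalent when,
after multiplication by monomials in the `Δ`-variables, their monomials agree modulo `I` up to a
nonzero scalar. As `I` is binomial, projecting onto a class preserves `I`, so membership in `I` can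
be tested class by class.

An element of the right side is `i + m` with `i ∈ I` and `m ∈ M_emb(I)`. Let `w` occur in `m` and
let `b` be its part outside `Δ`, which is equivalent to `w`. If `x^b ∈ I`, the class of `b` projects
everything into `I`. Otherwise `(I : x^b) ∩ k[ℕ^Δ]` is a lattice ideal (`exists_latticeIdeal_eq`),
embedded because `x^b` is a multiple of an embedded witness, so it contains some minimal `I(τ_j)`.
That ideal multiplies `x^b`, hence every monomial of its class, into `I`, so the class projection
sends `I + k[x]·I(τ_j)` into `I`. The saturation does no harm: the `Δ`-variables are nonzerodivisors
and multiplication by them commutes with the projection. -/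

/-! ### Projections onto sets of monomials -/

section Projection

variable {k σ : Type*} [Field k]

open Classical in
/-- The `k`-linear projection onto the span of the monomials with exponent in `C`. -/
noncomputable def monomialProj (k : Type*) [Field k] {σ : Type*} (C : Set (σ →₀ ℕ)) :
    MvPolynomial σ k →ₗ[k] MvPolynomial σ k :=
  (basisMonomials σ k).constr k fun w => if w ∈ C then monomial w 1 else 0

open Classical in
theorem monomialProj_monomial (C : Set (σ →₀ ℕ)) (w : σ →₀ ℕ) (c : k) :
    monomialProj k C (monomial w c) = if w ∈ C then monomial w c else 0 := by
  have h : (monomial w c : MvPolynomial σ k) = c • basisMonomials σ k w := by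
    simp [smul_monomial]
  rw [h, map_smul, monomialProj, Module.Basis.constr_basis]
  split_ifs <;> simp [smul_monomial]

theorem monomialProj_monomial_of_mem {C : Set (σ →₀ ℕ)} {w : σ →₀ ℕ} (hw : w ∈ C) (c : k) :
    monomialProj k C (monomial w c) = monomial w c := by
  rw [monomialProj_monomial, if_pos hw]

theorem monomialProj_monomial_of_notMem {C : Set (σ →₀ ℕ)} {w : σ →₀ ℕ} (hw : w ∉ C) (c : k) :
    monomialProj k C (monomial w c) = 0 := by
  rw [monomialProj_monomial, if_neg hw]

open Classical in
theorem coeff_monomialProj (C : Set (σ →₀ ℕ)) (w : σ →₀ ℕ) (f : MvPolynomial σ k) :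
    coeff w (monomialProj k C f) = if w ∈ C then coeff w f else 0 := by
  induction f using MvPolynomial.induction_on' with
  | monomial u a =>
    by_cases hu : u ∈ C
    · rw [monomialProj_monomial_of_mem hu, coeff_monomial]
      split_ifs <;> simp_all
    · rw [monomialProj_monomial_of_notMem hu, coeff_monomial, coeff_zero]
      split_ifs <;> simp_all
  | add p q hp hq => rw [map_add, coeff_add, coeff_add, hp, hq]; split_ifs <;> simp

theorem monomialProj_monomial_mul {C : Set (σ →₀ ℕ)} {u : σ →₀ ℕ}
    (hu : ∀ w, u + w ∈ C ↔ w ∈ C) (a : k) (f : MvPolynomial σ k) :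
    monomialProj k C (monomial u a * f) = monomial u a * monomialProj k C f := by
  classical
  induction f using MvPolynomial.induction_on' with
  | monomial w b =>
    rw [monomial_mul, monomialProj_monomial, monomialProj_monomial, if_congr (hu w) rfl rfl]
    split_ifs <;> simp [monomial_mul]
  | add p q hp hq => rw [mul_add, map_add, map_add, mul_add, hp, hq]

/-- A binomial with both exponents in, or both outside, a set of exponents is either fixed or killed
by the projection; hence the projection preserves a binomial ideal if this holds for all binomials
of the ideal. -/
theorem monomialProj_mem_of_isBinomialIdeal {I : Ideal (MvPolynomial σ k)}
    (hI : IsBinomialIdeal I) {C : Set (σ →₀ ℕ)}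
    (hC : ∀ u v (c : k), c ≠ 0 → monomial u 1 - monomial v c ∈ I → (u ∈ C ↔ v ∈ C))
    {f : MvPolynomial σ k} (hf : f ∈ I) : monomialProj k C f ∈ I := by
  obtain ⟨S, hS, rfl⟩ := hI
  classical
  have key : ∀ s ∈ S, ∀ p : MvPolynomial σ k, monomialProj k C (p * s) ∈ Ideal.span S := by
    intro s hs p
    induction p using MvPolynomial.induction_on' with
    | add p q hp hq => rw [add_mul, map_add]; exact Ideal.add_mem _ hp hq
    | monomial w a =>
      have hsI : s ∈ Ideal.span S := Ideal.subset_span hs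
      have hwI : monomial w a * s ∈ Ideal.span S := Ideal.mul_mem_left _ _ hsI
      have hcard := hS s hs
      by_cases ha : a = 0
      · simp [ha]
      interval_cases hc : s.support.card
      · have h0 : s = 0 := by simpa using hc
        simp [h0]
      · obtain ⟨u, hu⟩ := Finset.card_eq_one.1 hc
        rw [as_sum s, hu, Finset.sum_singleton, monomial_mul] at hwI ⊢
        rw [monomialProj_monomial]
        split_ifs
        · exact hwI
        · exact Ideal.zero_mem _
      · obtain ⟨u, v, huv, hu⟩ := Finset.card_eq_two.1 hc
        have hcu : coeff u s ≠ 0 := mem_support_iff.1 (by simp [hu])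
        have hcv : coeff v s ≠ 0 := mem_support_iff.1 (by simp [hu])
        rw [as_sum s, hu, Finset.sum_pair huv, mul_add, monomial_mul, monomial_mul] at hwI ⊢
        have hiff : w + u ∈ C ↔ w + v ∈ C := by
          -- The scalar comes from dividing the binomial by its first coefficient.
          refine hC _ _ (-((a * coeff u s)⁻¹ * (a * coeff v s))) ?_ ?_
          · exact neg_ne_zero.2 (mul_ne_zero (inv_ne_zero (mul_ne_zero ha hcu))
              (mul_ne_zero ha hcv))
          · have := Ideal.mul_mem_left _ (MvPolynomial.C (a * coeff u s)⁻¹) hwI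
            rwa [mul_add, C_mul_monomial, C_mul_monomial,
              inv_mul_cancel₀ (mul_ne_zero ha hcu), ← sub_neg_eq_add, ← map_neg] at this
        rw [map_add, monomialProj_monomial, monomialProj_monomial, hiff]
        split_ifs
        · exact hwI
        · simp
  have h := Submodule.span_induction
    (p := fun g _ => ∀ p, monomialProj k C (p * g) ∈ Ideal.span S)
    key (by simp)
    (fun x y _ _ hx hy p => by rw [mul_add, map_add]; exact Ideal.add_mem _ (hx p) (hy p))
    (fun a x _ hx p => by rw [smul_eq_mul, ← mul_assoc]; exact hx _) hf 1
  rwa [one_mul] at h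

/-- If an ideal is preserved by the projections onto the classes of an equivalence relation, then
it contains every polynomial whose projections it contains. -/
theorem mem_of_monomialProj_mem {I : Ideal (MvPolynomial σ k)} (r : (σ →₀ ℕ) → (σ →₀ ℕ) → Prop)
    (hr : ∀ w, r w w) (hI : ∀ w, ∀ f ∈ I, monomialProj k {v | r w v} f ∈ I)
    (f : MvPolynomial σ k) (hf : ∀ w ∈ f.support, monomialProj k {v | r w v} f ∈ I) : f ∈ I := by
  classical
  induction hn : f.support.card using Nat.strong_induction_on generalizing f with
  | _ m ih =>
    by_cases h0 : f = 0
    · rw [h0]; exact I.zero_mem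
    obtain ⟨w, hw⟩ := Finset.nonempty_of_ne_empty (mt support_eq_empty.1 h0)
    -- Removing the class of `w` loses at least `w`, by reflexivity, so the support shrinks.
    have hsub : (f - monomialProj k {v | r w v} f).support ⊂ f.support := by
      refine Finset.ssubset_iff_subset_ne.2 ⟨fun v hv => ?_, fun h => ?_⟩
      · rw [mem_support_iff, coeff_sub, coeff_monomialProj] at hv
        rw [mem_support_iff]
        split_ifs at hv <;> simp_all
      · rw [← h, mem_support_iff, coeff_sub, coeff_monomialProj,
          if_pos (show w ∈ {v | r w v} from hr w)] at hw
        simp at hw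
    have := ih _ (hn ▸ Finset.card_lt_card hsub) (f - monomialProj k {v | r w v} f)
      (fun v hv => by
        rw [map_sub]
        exact I.sub_mem (hf v (hsub.1 hv)) (hI _ _ (hf w hw))) rfl
    simpa using I.add_mem this (hf w hw)

end Projection

/-! ### Lattice ideals and their characters -/

section LatticeIdeal

variable {k ι : Type*} [Field k]

theorem expDiff_eq_expDiff_iff {u v u' v' : ι →₀ ℕ} :
    expDiff u v = expDiff u' v' ↔ u + v' = u' + v := by
  constructor
  · intro h
    ext i
    have := congrFun h i
    simp only [expDiff, Finsupp.add_apply] at this ⊢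
    omega
  · intro h
    ext i
    have := DFunLike.congr_fun h i
    simp only [expDiff, Finsupp.add_apply] at this ⊢
    omega

theorem expDiff_add (u v u' v' : ι →₀ ℕ) :
    expDiff u v + expDiff u' v' = expDiff (u + u') (v + v') := by
  ext i
  simp only [expDiff, Pi.add_apply, Finsupp.add_apply]
  push_cast
  ring

theorem neg_expDiff (u v : ι →₀ ℕ) : -expDiff u v = expDiff v u := by
  ext i
  simp [expDiff]

theorem monomial_sub_monomial_mul (u v u' v' : ι →₀ ℕ) (c d : k) (K : Ideal (MvPolynomial ι k))
    (h : monomial u 1 - monomial v c ∈ K) (h' : monomial u' 1 - monomial v' d ∈ K) :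
    monomial (u + u') 1 - monomial (v + v') (c * d) ∈ K := by
  have := K.add_mem (K.mul_mem_left (monomial u' 1) h) (K.mul_mem_left (monomial v c) h')
  simp only [mul_sub, monomial_mul, one_mul, mul_one] at this
  rw [add_comm u' u, add_comm u' v] at this
  simpa using this

theorem monomial_sub_monomial_symm {u v : ι →₀ ℕ} {c : k} (hc : c ≠ 0)
    {K : Ideal (MvPolynomial ι k)} (h : monomial u 1 - monomial v c ∈ K) :
    monomial v 1 - monomial u c⁻¹ ∈ K := by
  have := K.mul_mem_left (MvPolynomial.C (-c⁻¹)) h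
  rwa [mul_sub, C_mul_monomial, C_mul_monomial, neg_mul, neg_mul, inv_mul_cancel₀ hc, mul_one,
    map_neg, map_neg, neg_sub_neg] at this

open Classical in
/-- The linear functional that reads a polynomial modulo `I(τ)` along the coset `w + L_τ`. -/
noncomputable def PartialCharacter.cosetFunctional (τ : PartialCharacter k ι) (w : ι →₀ ℕ) :
    MvPolynomial ι k →ₗ[k] k :=
  (basisMonomials ι k).constr k fun u =>
    if h : expDiff u w ∈ τ.lattice then
      (τ.char (Multiplicative.ofAdd ⟨expDiff u w, h⟩) : k) else 0

open Classical in
theorem PartialCharacter.cosetFunctional_monomial (τ : PartialCharacter k ι) (w u : ι →₀ ℕ)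
    (c : k) : τ.cosetFunctional w (monomial u c) = c *
      if h : expDiff u w ∈ τ.lattice then
        (τ.char (Multiplicative.ofAdd ⟨expDiff u w, h⟩) : k) else 0 := by
  have h : (monomial u c : MvPolynomial ι k) = c • basisMonomials ι k u := by
    simp [smul_monomial]
  rw [h, map_smul, cosetFunctional, Module.Basis.constr_basis, smul_eq_mul]

/-- The two exponents of a monomial multiple of a generator differ by an element of the lattice, so
they lie both in the coset of `w` or both outside; inside, multiplicativity of the character makes
the two values cancel. -/
theorem PartialCharacter.cosetFunctional_eq_zero (τ : PartialCharacter k ι) (w : ι →₀ ℕ)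
    {f : MvPolynomial ι k} (hf : f ∈ τ.latticeIdeal) : τ.cosetFunctional w f = 0 := by
  have key : ∀ (u v : ι →₀ ℕ) (h : expDiff u v ∈ τ.lattice) (p : MvPolynomial ι k),
      τ.cosetFunctional w (p * (monomial u 1 -
        monomial v (τ.char (Multiplicative.ofAdd ⟨expDiff u v, h⟩) : k))) = 0 := by
    intro u v h p
    induction p using MvPolynomial.induction_on' with
    | add p q hp hq => rw [add_mul, map_add, hp, hq, add_zero]
    | monomial s a =>
      rw [mul_sub, monomial_mul, monomial_mul, map_sub, cosetFunctional_monomial,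
        cosetFunctional_monomial]
      have hadd : expDiff (s + u) w = expDiff u v + expDiff (s + v) w := by
        rw [expDiff_add, expDiff_eq_expDiff_iff]
        abel
      by_cases hv : expDiff (s + v) w ∈ τ.lattice
      · have hu : expDiff (s + u) w ∈ τ.lattice := hadd ▸ τ.lattice.add_mem h hv
        rw [dif_pos hv, dif_pos hu, mul_one, mul_assoc, ← Units.val_mul, ← map_mul, ← ofAdd_add]
        simp only [AddMemClass.mk_add_mk, hadd, sub_self]
      · have hu : expDiff (s + u) w ∉ τ.lattice := fun hu => hv <| by
          rw [hadd] at hu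
          exact (AddSubgroup.add_mem_cancel_left _ h).1 hu
        rw [dif_neg hv, dif_neg hu, mul_zero, mul_zero, sub_zero]
  rw [PartialCharacter.latticeIdeal] at hf
  refine Submodule.span_induction (p := fun g _ => ∀ p, τ.cosetFunctional w (p * g) = 0)
    ?_ ?_ ?_ ?_ hf 1 |> fun h => by simpa using h
  · rintro _ ⟨u, v, h, rfl⟩ p
    exact key u v h p
  · simp
  · intro x y _ _ hx hy p
    rw [mul_add, map_add, hx, hy, add_zero]
  · intro a x _ hx p
    rw [smul_eq_mul, ← mul_assoc]
    exact hx _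

/-- Otherwise the coset functional at `v` would see only the second term and return `-c`. Thus the
ideal determines its lattice, which makes ranks comparable. -/
theorem PartialCharacter.mem_lattice_of_mem_latticeIdeal (τ : PartialCharacter k ι)
    {u v : ι →₀ ℕ} {c : k} (hc : c ≠ 0) (h : monomial u 1 - monomial v c ∈ τ.latticeIdeal) :
    expDiff u v ∈ τ.lattice := by
  by_contra hn
  have h0 := τ.cosetFunctional_eq_zero v h
  have hv : expDiff v v = 0 := by ext i; simp [expDiff]
  rw [map_sub, cosetFunctional_monomial, cosetFunctional_monomial, dif_neg hn,
    dif_pos (hv ▸ τ.lattice.zero_mem)] at h0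
  simp [hc] at h0

theorem exists_expDiff_eq [Finite ι] (d : ι → ℤ) : ∃ u v : ι →₀ ℕ, expDiff u v = d := by
  refine ⟨Finsupp.equivFunOnFinite.symm fun i => (d i).toNat,
    Finsupp.equivFunOnFinite.symm fun i => (-d i).toNat, ?_⟩
  ext i
  simp only [expDiff, Finsupp.equivFunOnFinite_symm_apply_apply]
  omega

theorem PartialCharacter.lattice_le_of_latticeIdeal_le [Finite ι] {τ τ' : PartialCharacter k ι}
    (h : τ.latticeIdeal ≤ τ'.latticeIdeal) : τ.lattice ≤ τ'.lattice := by
  intro d hd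
  obtain ⟨u, v, rfl⟩ := exists_expDiff_eq d
  exact τ'.mem_lattice_of_mem_latticeIdeal (Units.ne_zero _)
    (h (Ideal.subset_span ⟨u, v, hd, rfl⟩))

theorem PartialCharacter.rank_le_of_latticeIdeal_le [Finite ι] {τ τ' : PartialCharacter k ι}
    (h : τ.latticeIdeal ≤ τ'.latticeIdeal) : τ.rank ≤ τ'.rank := by
  have : Module.Finite ℤ τ'.lattice :=
    inferInstanceAs (Module.Finite ℤ (AddSubgroup.toIntSubmodule τ'.lattice))
  exact LinearMap.finrank_le_finrank_of_injective
    (f := (AddSubgroup.inclusion (lattice_le_of_latticeIdeal_le h)).toIntLinearMap)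
    (AddSubgroup.inclusion_injective (lattice_le_of_latticeIdeal_le h))

/-- A proper ideal modulo which all monomials are nonzerodivisors is a lattice ideal if every
exponent of each of its elements is matched to another one by a binomial of the ideal. -/
theorem exists_latticeIdeal_eq (K : Ideal (MvPolynomial ι k)) (hK : 1 ∉ K)
    (hcancel : ∀ u g, monomial u 1 * g ∈ K → g ∈ K)
    (hbin : ∀ g ∈ K, ∀ w ∈ g.support, ∃ w' ∈ g.support, w' ≠ w ∧
      ∃ c : k, c ≠ 0 ∧ monomial w 1 - monomial w' c ∈ K) :
    ∃ τ : PartialCharacter k ι, K = τ.latticeIdeal := by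
  classical
  have hmon : ∀ u (c : k), monomial u c ∈ K → c = 0 := by
    intro u c h
    by_contra hc
    refine hK (hcancel u 1 ?_)
    simpa [C_mul_monomial, hc] using K.mul_mem_left (MvPolynomial.C c⁻¹) h
  -- The graph of the character to be built. Cancellation makes it independent of the chosen `u`,
  -- `v`, and properness makes it single-valued.
  let P : (ι → ℤ) → kˣ → Prop := fun d c =>
    ∃ u v, expDiff u v = d ∧ monomial u 1 - monomial v (c : k) ∈ K
  have hall : ∀ d c, P d c → ∀ u v, expDiff u v = d → monomial u 1 - monomial v (c : k) ∈ K := by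
    rintro d c ⟨u', v', rfl, h⟩ u v huv
    rw [expDiff_eq_expDiff_iff] at huv
    refine hcancel v' _ ?_
    have := K.mul_mem_left (monomial v 1) h
    rw [mul_sub, monomial_mul, monomial_mul, one_mul, one_mul] at this ⊢
    rwa [add_comm v' u, huv, add_comm u' v, add_comm v' v]
  have huniq : ∀ d c c', P d c → P d c' → c = c' := by
    rintro d c c' ⟨u, v, huv, h⟩ h'
    have := K.sub_mem (hall d c' h' u v huv) h
    rw [sub_sub_sub_cancel_left, ← map_sub] at this
    exact Units.ext (sub_eq_zero.1 (hmon _ _ this))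
  have hadd : ∀ d c d' c', P d c → P d' c' → P (d + d') (c * c') := by
    rintro _ c _ c' ⟨u, v, rfl, h⟩ ⟨u', v', rfl, h'⟩
    exact ⟨u + u', v + v', (expDiff_add _ _ _ _).symm,
      monomial_sub_monomial_mul _ _ _ _ _ _ _ h h'⟩
  let L : AddSubgroup (ι → ℤ) :=
    { carrier := {d | ∃ c, P d c}
      add_mem' := by
        rintro d d' ⟨c, h⟩ ⟨c', h'⟩
        exact ⟨_, hadd _ _ _ _ h h'⟩
      zero_mem' := ⟨1, 0, 0, by ext i; simp [expDiff], by simp⟩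
      neg_mem' := by
        rintro _ ⟨c, u, v, rfl, h⟩
        refine ⟨c⁻¹, v, u, (neg_expDiff u v).symm, ?_⟩
        simpa using monomial_sub_monomial_symm c.ne_zero h }
  choose χ hχ using fun d : L => d.2
  let τ : PartialCharacter k ι :=
    { lattice := L
      char := MonoidHom.mk' (fun d => χ d.toAdd) fun d d' =>
        huniq _ _ _ (hχ (d * d').toAdd) (hadd _ _ _ _ (hχ d.toAdd) (hχ d'.toAdd)) }
  have hgen : ∀ u v (c : k), c ≠ 0 → monomial u 1 - monomial v c ∈ K →
      monomial u 1 - monomial v c ∈ τ.latticeIdeal := by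
    intro u v c hc h
    have hP : P (expDiff u v) (Units.mk0 c hc) := ⟨u, v, rfl, h⟩
    have hL : expDiff u v ∈ L := ⟨_, hP⟩
    refine Ideal.subset_span ⟨u, v, hL, ?_⟩
    have : χ ⟨expDiff u v, hL⟩ = Units.mk0 c hc := huniq _ _ _ (hχ ⟨_, hL⟩) hP
    change _ = monomial u 1 - monomial v ((χ ⟨expDiff u v, hL⟩ : kˣ) : k)
    rw [this, Units.val_mk0]
  refine ⟨τ, le_antisymm (fun g hg => ?_) (Ideal.span_le.2 ?_)⟩
  · induction hn : g.support.card using Nat.strong_induction_on generalizing g with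
    | _ m ih =>
      by_cases h0 : g = 0
      · rw [h0]; exact Ideal.zero_mem _
      obtain ⟨w, hw⟩ := Finset.nonempty_of_ne_empty (mt support_eq_empty.1 h0)
      obtain ⟨w', hw', hne, c, hc, hcK⟩ := hbin g hg w hw
      -- Subtracting `b` cancels the term at `w` and adds no exponent, since `w'` already occurs in
      -- `g`.
      set b : MvPolynomial ι k := MvPolynomial.C (coeff w g) * (monomial w 1 - monomial w' c)
        with hb
      have hbK : b ∈ K := K.mul_mem_left _ hcK
      have hcoeff : ∀ v, coeff v b =
          coeff w g * ((if w = v then 1 else 0) - if w' = v then c else 0) := fun v => by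
        rw [hb, coeff_C_mul, coeff_sub, coeff_monomial, coeff_monomial]
      have hsub : (g - b).support ⊂ g.support := by
        refine Finset.ssubset_iff_subset_ne.2 ⟨fun v hv => ?_, fun h => ?_⟩
        · by_contra hvg
          have h1 : w ≠ v := fun h => hvg (h ▸ hw)
          have h2 : w' ≠ v := fun h => hvg (h ▸ hw')
          rw [mem_support_iff, coeff_sub, hcoeff, if_neg h1, if_neg h2] at hv
          simp [notMem_support_iff.1 hvg] at hv
        · rw [← h, mem_support_iff, coeff_sub, hcoeff, if_pos rfl, if_neg hne] at hw
          simp at hw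
      have := ih _ (hn ▸ Finset.card_lt_card hsub) (g - b) (K.sub_mem hg hbK) rfl
      have hsum := Ideal.add_mem _ this (Ideal.mul_mem_left _ (MvPolynomial.C (coeff w g))
        (hgen _ _ _ hc hcK))
      rwa [← hb, sub_add_cancel] at hsum
  · rintro _ ⟨u, v, h, rfl⟩
    exact hall _ _ (hχ ⟨_, h⟩) u v rfl

end LatticeIdeal

/-! ### Cellular binomial ideals and the relation on exponents -/

section Cellular

variable {k : Type*} [Field k] {n : ℕ} {Δ : Finset (Fin n)} {I : Ideal (MvPolynomial (Fin n) k)}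

theorem IsCellular.mem_of_monomial_mul_mem (hcell : IsCellular Δ I) {u : Fin n →₀ ℕ}
    (hu : ∀ i ∉ Δ, u i = 0) {g : MvPolynomial (Fin n) k} (h : monomial u 1 * g ∈ I) : g ∈ I := by
  have hnzd : Ideal.Quotient.mk I (monomial u 1) ∈
      nonZeroDivisors (MvPolynomial (Fin n) k ⧸ I) := by
    rw [monomial_eq, C_1, one_mul, Finsupp.prod, map_prod]
    refine Submonoid.prod_mem _ fun i hi => ?_
    rw [map_pow]
    refine Submonoid.pow_mem _ ((hcell.2 i).1 ?_) _
    by_contra hiΔ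
    exact Finsupp.mem_support_iff.1 hi (hu i hiΔ)
  rw [← Ideal.Quotient.eq_zero_iff_mem] at h ⊢
  rw [map_mul] at h
  exact (mem_nonZeroDivisors_iff.1 hnzd).1 _ h

variable (Δ I) in
/-- Two exponents are related if, up to multiplying by monomials in the variables in `Δ`, their
monomials are nonzero scalar multiples of each other modulo `I`. -/
def MonomialRel (w w' : Fin n →₀ ℕ) : Prop :=
  ∃ (u u' : Fin n →₀ ℕ) (c : k), (∀ i ∉ Δ, u i = 0) ∧ (∀ i ∉ Δ, u' i = 0) ∧ c ≠ 0 ∧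
    monomial (u + w) 1 - monomial (u' + w') c ∈ I

theorem MonomialRel.refl (w : Fin n →₀ ℕ) : MonomialRel Δ I w w :=
  ⟨0, 0, 1, by simp, by simp, one_ne_zero, by simp⟩

theorem MonomialRel.symm {w w' : Fin n →₀ ℕ} (h : MonomialRel Δ I w w') :
    MonomialRel Δ I w' w := by
  obtain ⟨u, u', c, hu, hu', hc, h⟩ := h
  exact ⟨u', u, c⁻¹, hu', hu, inv_ne_zero hc, monomial_sub_monomial_symm hc h⟩

theorem MonomialRel.trans {w₁ w₂ w₃ : Fin n →₀ ℕ} (h₁₂ : MonomialRel Δ I w₁ w₂)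
    (h₂₃ : MonomialRel Δ I w₂ w₃) : MonomialRel Δ I w₁ w₃ := by
  obtain ⟨u, u', c, hu, hu', hc, h⟩ := h₁₂
  obtain ⟨v, v', d, hv, hv', hd, h'⟩ := h₂₃
  refine ⟨v + u, u' + v', c * d, fun i hi => by simp [hu i hi, hv i hi],
    fun i hi => by simp [hu' i hi, hv' i hi], mul_ne_zero hc hd, ?_⟩
  have := I.add_mem (I.mul_mem_left (monomial v 1) h) (I.mul_mem_left (monomial u' c) h')
  simp only [mul_sub, monomial_mul, one_mul, mul_one] at this
  rw [add_left_comm v u' w₂, sub_add_sub_cancel] at this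
  rwa [add_assoc, add_assoc]

theorem MonomialRel.of_mem {w w' : Fin n →₀ ℕ} {c : k} (hc : c ≠ 0)
    (h : monomial w 1 - monomial w' c ∈ I) : MonomialRel Δ I w w' :=
  ⟨0, 0, c, by simp, by simp, hc, by simpa using h⟩

theorem MonomialRel.add_left {u : Fin n →₀ ℕ} (hu : ∀ i ∉ Δ, u i = 0) (w : Fin n →₀ ℕ) :
    MonomialRel Δ I (u + w) w :=
  ⟨0, u, 1, by simp, hu, one_ne_zero, by simp⟩

theorem monomialRel_add_iff {u : Fin n →₀ ℕ} (hu : ∀ i ∉ Δ, u i = 0) (w v : Fin n →₀ ℕ) :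
    u + v ∈ {v | MonomialRel Δ I w v} ↔ v ∈ {v | MonomialRel Δ I w v} :=
  ⟨fun h => h.trans (.add_left hu v), fun h => h.trans (MonomialRel.add_left hu v).symm⟩

theorem IsBinomialIdeal.monomialProj_monomialRel_mem (hbin : IsBinomialIdeal I)
    (w : Fin n →₀ ℕ) {f : MvPolynomial (Fin n) k} (hf : f ∈ I) :
    monomialProj k {v | MonomialRel Δ I w v} f ∈ I :=
  monomialProj_mem_of_isBinomialIdeal hbin (fun _ _ _ hc h =>
    ⟨fun hu => hu.trans (.of_mem hc h), fun hv => hv.trans (MonomialRel.of_mem hc h).symm⟩) hf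

theorem inclPoly_monomial (u : {i // i ∈ Δ} →₀ ℕ) (c : k) :
    inclPoly k Δ (monomial u c) = monomial (u.mapDomain Subtype.val) c :=
  rename_monomial _ _ _

theorem mapDomain_val_eq_zero (u : {i // i ∈ Δ} →₀ ℕ) : ∀ i ∉ Δ, u.mapDomain Subtype.val i = 0 :=
  fun _ hi => Finsupp.mapDomain_of_notMem_range _ _ (by simpa using hi)

theorem mem_elimIdeal_colon {b : Fin n →₀ ℕ} {g : MvPolynomial {i // i ∈ Δ} k} :
    g ∈ elimIdeal Δ (Submodule.colon I {monomial b (1 : k)}) ↔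
      inclPoly k Δ g * monomial b 1 ∈ I := by
  rw [elimIdeal, Ideal.mem_comap, Submodule.mem_colon_singleton, smul_eq_mul]

/-- For a monomial `x^b ∉ I` in the nilpotent variables, `(I : x^b) ∩ k[ℕ^Δ]` is a lattice
ideal. -/
theorem IsCellular.exists_isWitness (hcell : IsCellular Δ I) (hbin : IsBinomialIdeal I)
    {b : Fin n →₀ ℕ} (hb : ∀ i ∈ Δ, b i = 0) (hbI : monomial b 1 ∉ I) :
    ∃ τ : PartialCharacter k {i // i ∈ Δ}, IsWitness Δ I b τ := by
  classical
  refine (exists_latticeIdeal_eq (elimIdeal Δ (Submodule.colon I {monomial b (1 : k)}))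
    ?_ ?_ ?_).imp fun τ hτ => ⟨hb, hτ⟩
  · rwa [mem_elimIdeal_colon, map_one, one_mul]
  · intro u g h
    rw [mem_elimIdeal_colon] at h ⊢
    rw [map_mul, inclPoly_monomial, mul_assoc] at h
    exact hcell.mem_of_monomial_mul_mem (mapDomain_val_eq_zero u) h
  · intro g hg w hw
    rw [mem_elimIdeal_colon] at hg
    let e : ({i // i ∈ Δ} →₀ ℕ) → (Fin n →₀ ℕ) := fun u => u.mapDomain Subtype.val + b
    -- If no other exponent of `g` is matched to `w`, projecting onto `D` isolates the term at `w`;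
    -- cancelling its `Δ`-part would put `x^b` in `I`.
    let D : Set (Fin n →₀ ℕ) := {v | ∃ c : k, c ≠ 0 ∧ monomial (e w) 1 - monomial v c ∈ I}
    have htrans : ∀ u v (d : k), d ≠ 0 → monomial u 1 - monomial v d ∈ I → u ∈ D → v ∈ D := by
      rintro u v d hd h ⟨c, hc, h'⟩
      refine ⟨c * d, mul_ne_zero hc hd, ?_⟩
      have := I.add_mem h' (I.mul_mem_left (C c) h)
      rwa [mul_sub, C_mul_monomial, C_mul_monomial, mul_one, sub_add_sub_cancel] at this
    have hproj := monomialProj_mem_of_isBinomialIdeal hbin (C := D) (fun u v d hd h =>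
      ⟨htrans u v d hd h, htrans v u d⁻¹ (inv_ne_zero hd) (monomial_sub_monomial_symm hd h)⟩) hg
    by_contra! hne
    have hD : ∀ w' ∈ g.support, w' ≠ w → e w' ∉ D := by
      rintro w' hw' hww' ⟨c, hc, h⟩
      refine hne w' hw' hww' c hc ?_
      rw [mem_elimIdeal_colon, map_sub, inclPoly_monomial, inclPoly_monomial, sub_mul,
        monomial_mul, monomial_mul, mul_one, mul_one]
      exact h
    have hwD : e w ∈ D := ⟨1, one_ne_zero, by simp⟩
    rw [as_sum g, map_sum, Finset.sum_mul, map_sum, Finset.sum_eq_single w] at hproj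
    · rw [inclPoly_monomial, monomial_mul, mul_one, monomialProj_monomial_of_mem hwD] at hproj
      have := I.mul_mem_left (C (coeff w g)⁻¹) hproj
      rw [C_mul_monomial, inv_mul_cancel₀ (mem_support_iff.1 hw), ← one_mul (1 : k),
        ← monomial_mul] at this
      exact hbI (hcell.mem_of_monomial_mul_mem (mapDomain_val_eq_zero w) this)
    · intro w' hw' hww'
      rw [inclPoly_monomial, monomial_mul, monomialProj_monomial_of_notMem (hD w' hw' hww')]
    · exact fun h => absurd hw h

theorem monomialProj_inclPoly_mul (w : Fin n →₀ ℕ) (j : MvPolynomial {i // i ∈ Δ} k)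
    (g : MvPolynomial (Fin n) k) :
    monomialProj k {v | MonomialRel Δ I w v} (inclPoly k Δ j * g) =
      inclPoly k Δ j * monomialProj k {v | MonomialRel Δ I w v} g := by
  induction j using MvPolynomial.induction_on' with
  | monomial u a =>
    rw [inclPoly_monomial,
      monomialProj_monomial_mul (monomialRel_add_iff (mapDomain_val_eq_zero u) w)]
  | add p q hp hq => rw [map_add, add_mul, add_mul, map_add, hp, hq]

/-- Multiply the relation between `x^(u+b)` and `x^(u'+v)` by `j` and cancel the nonzerodivisor
`x^u'`. -/
theorem IsCellular.inclPoly_mul_monomial_mem (hcell : IsCellular Δ I) {b v : Fin n →₀ ℕ}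
    (hbv : MonomialRel Δ I b v) {j : MvPolynomial {i // i ∈ Δ} k}
    (hj : inclPoly k Δ j * monomial b 1 ∈ I) (a : k) : inclPoly k Δ j * monomial v a ∈ I := by
  obtain ⟨u, u', c, hu, hu', hc, h⟩ := hbv
  refine hcell.mem_of_monomial_mul_mem hu' ?_
  have h₁ := I.mul_mem_left (C (a * c⁻¹)) (I.sub_mem (I.mul_mem_left (monomial u 1) hj)
    (I.mul_mem_left (inclPoly k Δ j) h))
  have h₂ : (monomial (u' + v) c : MvPolynomial (Fin n) k) =
      C c * monomial u' 1 * monomial v 1 := by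
    rw [mul_assoc, monomial_mul, C_mul_monomial, mul_one, mul_one]
  have h₃ : (monomial (u + b) 1 : MvPolynomial (Fin n) k) = monomial u 1 * monomial b 1 := by
    rw [monomial_mul, mul_one]
  have h₄ : (monomial v a : MvPolynomial (Fin n) k) = C a * monomial v 1 := by
    rw [C_mul_monomial, mul_one]
  have h₅ : (C c⁻¹ * C c : MvPolynomial (Fin n) k) = 1 := by
    rw [← C_mul, inv_mul_cancel₀ hc, C_1]
  rw [h₂, h₃, C_mul] at h₁
  rw [h₄]
  convert h₁ using 1
  linear_combination (-(C a * monomial u' 1 * monomial v 1 * inclPoly k Δ j)) * h₅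

/-- Elements of `J` commute with the projection, which leaves only monomials equivalent to `x^b`,
and `J` multiplies these into `I`. -/
theorem IsCellular.monomialProj_mem_of_mem_sup (hcell : IsCellular Δ I) (hbin : IsBinomialIdeal I)
    {b : Fin n →₀ ℕ} {J : Ideal (MvPolynomial {i // i ∈ Δ} k)}
    (hJ : J ≤ elimIdeal Δ (Submodule.colon I {monomial b (1 : k)}))
    {f : MvPolynomial (Fin n) k} (hf : f ∈ I ⊔ J.map (inclPoly k Δ)) :
    monomialProj k {v | MonomialRel Δ I b v} f ∈ I := by
  obtain ⟨i, hi, g, hg, rfl⟩ := Submodule.mem_sup.1 hf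
  rw [map_add]
  refine I.add_mem (hbin.monomialProj_monomialRel_mem b hi) ?_
  have h := Submodule.span_induction
    (p := fun g _ => ∀ p, monomialProj k {v | MonomialRel Δ I b v} (p * g) ∈ I)
    ?_ (by simp)
    (fun x y _ _ hx hy p => by rw [mul_add, map_add]; exact Ideal.add_mem _ (hx p) (hy p))
    (fun a x _ hx p => by rw [smul_eq_mul, ← mul_assoc]; exact hx _) hg 1
  · rwa [one_mul] at h
  rintro _ ⟨j, hj, rfl⟩ p
  rw [mul_comm]
  change monomialProj k _ (inclPoly k Δ j * p) ∈ I
  rw [monomialProj_inclPoly_mul]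
  induction p using MvPolynomial.induction_on' with
  | monomial v a =>
    by_cases hv : v ∈ {v | MonomialRel Δ I b v}
    · rw [monomialProj_monomial_of_mem hv]
      exact hcell.inclPoly_mul_monomial_mem hv (mem_elimIdeal_colon.1 (hJ hj)) a
    · rw [monomialProj_monomial_of_notMem hv, mul_zero]
      exact I.zero_mem
  | add p q hp hq => rw [map_add, mul_add]; exact I.add_mem hp hq

theorem IsCellular.monomialProj_mem_of_mem_idealSaturation (hcell : IsCellular Δ I)
    (hbin : IsBinomialIdeal I) {b : Fin n →₀ ℕ} {J : Ideal (MvPolynomial {i // i ∈ Δ} k)}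
    (hJ : J ≤ elimIdeal Δ (Submodule.colon I {monomial b (1 : k)}))
    {f : MvPolynomial (Fin n) k}
    (hf : f ∈ idealSaturation (I ⊔ J.map (inclPoly k Δ)) (∏ i ∈ Δ, X i)) :
    monomialProj k {v | MonomialRel Δ I b v} f ∈ I := by
  obtain ⟨N, hN⟩ := hf
  have hX : (∏ i ∈ Δ, X i : MvPolynomial (Fin n) k) ^ N =
      monomial (N • ∑ i ∈ Δ, Finsupp.single i 1) 1 := by
    simp only [X, ← monomial_sum_one, monomial_pow, one_pow]
  have hu : ∀ j ∉ Δ, (N • ∑ i ∈ Δ, Finsupp.single i 1 : Fin n →₀ ℕ) j = 0 := by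
    intro j hj
    rw [Finsupp.smul_apply, Finsupp.finsetSum_apply, Finset.sum_eq_zero, smul_zero]
    intro i hi
    exact Finsupp.single_eq_of_ne (by rintro rfl; exact hj hi)
  rw [hX, mul_comm] at hN
  have := hcell.monomialProj_mem_of_mem_sup hbin hJ hN
  rw [monomialProj_monomial_mul (monomialRel_add_iff hu b)] at this
  exact hcell.mem_of_monomial_mul_mem hu this

/-- Nilpotency of the variables outside `Δ` bounds the exponents of witness monomials not in `I`. -/
theorem IsCellular.finite_embeddedLatticeIdeals (hcell : IsCellular Δ I) :
    (embeddedLatticeIdeals Δ I).Finite := by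
  have hN : ∀ i, ∃ N : ℕ, i ∉ Δ → (X i : MvPolynomial (Fin n) k) ^ N ∈ I := by
    intro i
    by_cases hi : i ∈ Δ
    · exact ⟨0, fun h => absurd hi h⟩
    · obtain ⟨N, hN⟩ := (hcell.1 i).resolve_left fun h => hi ((hcell.2 i).2 h)
      refine ⟨N, fun _ => ?_⟩
      rwa [← map_pow, Ideal.Quotient.eq_zero_iff_mem] at hN
  choose N hN using hN
  -- Inserting `⊤` covers monomials in `I`, so properness of lattice ideals is not needed.
  refine ((Set.finite_Iic (Finsupp.equivFunOnFinite.symm N)).image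
    (fun a => elimIdeal Δ (Submodule.colon I {monomial a (1 : k)})) |>.insert ⊤).subset ?_
  rintro _ ⟨a, τ, ⟨⟨ha, hτ⟩, -⟩, rfl⟩
  by_cases haI : monomial a 1 ∈ I
  · left
    rw [← hτ, Ideal.eq_top_iff_one, mem_elimIdeal_colon, map_one, one_mul]
    exact haI
  · refine Or.inr ⟨a, fun i => ?_, hτ⟩
    by_contra! hi
    have hiΔ : i ∉ Δ := fun h => by simp [ha i h] at hi
    have hle : Finsupp.single i (N i) ≤ a :=
      Finsupp.single_le_iff.2 hi.le
    refine haI ?_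
    rw [← add_tsub_cancel_of_le hle, ← one_mul (1 : k), ← monomial_mul]
    refine I.mul_mem_right _ ?_
    rw [← X_pow_eq_monomial]
    exact hN i hiΔ

theorem exists_le_of_mem_embeddedMonomialIdeal {f : MvPolynomial (Fin n) k}
    (hf : f ∈ embeddedMonomialIdeal Δ I) : ∀ w ∈ f.support, ∃ (a : Fin n →₀ ℕ)
      (τ : PartialCharacter k {i // i ∈ Δ}), IsEmbeddedWitness Δ I a τ ∧ a ≤ w := by
  have h : embeddedMonomialIdeal Δ I = Ideal.span ((fun a => monomial a (1 : k)) ''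
      {a | ∃ τ : PartialCharacter k {i // i ∈ Δ}, IsEmbeddedWitness Δ I a τ}) := by
    refine congrArg Ideal.span (Set.ext fun g => ⟨?_, ?_⟩)
    · rintro ⟨a, τ, h, rfl⟩
      exact ⟨a, ⟨τ, h⟩, rfl⟩
    · rintro ⟨a, ⟨τ, h⟩, rfl⟩
      exact ⟨a, τ, h, rfl⟩
  rw [h, mem_ideal_span_monomial_image] at hf
  intro w hw
  obtain ⟨a, ⟨τ, h⟩, hle⟩ := hf w hw
  exact ⟨a, τ, h, hle⟩

/-- Multiples of a witness monomial of an embedded lattice witness embedded lattices. -/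
theorem IsEmbeddedWitness.of_le {a b : Fin n →₀ ℕ} {τ τ' : PartialCharacter k {i // i ∈ Δ}}
    (h : IsEmbeddedWitness Δ I a τ) (hab : a ≤ b) (h' : IsWitness Δ I b τ') :
    IsEmbeddedWitness Δ I b τ' := by
  obtain ⟨⟨-, hτ⟩, ρ, hρ, hlt⟩ := h
  refine ⟨h', ρ, hρ, hlt.trans_le (PartialCharacter.rank_le_of_latticeIdeal_le ?_)⟩
  rw [← hτ, ← h'.2]
  intro g hg
  rw [mem_elimIdeal_colon] at hg ⊢
  rw [← add_tsub_cancel_of_le hab, ← one_mul (1 : k), ← monomial_mul, ← mul_assoc]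
  exact I.mul_mem_right _ hg

end Cellular

/-! ### The decomposition -/

theorem mainTheorem7 {k : Type*} [Field k] (n : ℕ) (Δ : Finset (Fin n))
    (I : Ideal (MvPolynomial (Fin n) k)) (hbin : IsBinomialIdeal I) (hcell : IsCellular Δ I) :
    (minimalEmbeddedLatticeIdeals Δ I).Finite ∧
      I = (I ⊔ embeddedMonomialIdeal Δ I) ⊓
        ⨅ J ∈ minimalEmbeddedLatticeIdeals Δ I,
          idealSaturation (I ⊔ J.map (inclPoly k Δ)) (∏ i ∈ Δ, X i) := by
  have hfin := hcell.finite_embeddedLatticeIdeals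
  have hsat : ∀ J : Ideal (MvPolynomial {i // i ∈ Δ} k),
      I ≤ idealSaturation (I ⊔ J.map (inclPoly k Δ)) (∏ i ∈ Δ, X i) :=
    fun J g hg => ⟨0, by simpa using Ideal.mem_sup_left hg⟩
  refine ⟨hfin.subset fun J hJ => hJ.prop, le_antisymm
    (le_inf le_sup_left (le_iInf₂ fun J _ => hsat J)) ?_⟩
  rintro f ⟨hf, hfJ⟩
  obtain ⟨i, hi, m, hm, rfl⟩ := Submodule.mem_sup.1 hf
  refine I.add_mem hi (mem_of_monomialProj_mem (MonomialRel Δ I) .refl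
    (fun w g hg => hbin.monomialProj_monomialRel_mem w hg) m fun w hw => ?_)
  obtain ⟨a, τ, ha, haw⟩ := exists_le_of_mem_embeddedMonomialIdeal hm w hw
  set b := w.filter (fun i => i ∉ Δ) with hb
  have hbΔ : ∀ i ∈ Δ, b i = 0 := fun i hi => Finsupp.filter_apply_neg _ _ (by simpa using hi)
  have hab : a ≤ b := by
    intro i
    by_cases hi : i ∈ Δ
    · simp [ha.1.1 i hi]
    · rw [hb, Finsupp.filter_apply_pos (fun i => i ∉ Δ) _ hi]
      exact haw i
  have hwb : MonomialRel Δ I w b := by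
    have : w = w.filter (· ∈ Δ) + b := (Finsupp.filter_add_filter_not w _).symm
    rw [this]
    exact .add_left (fun i hi => Finsupp.filter_apply_neg _ _ hi) b
  have hclass : {v | MonomialRel Δ I w v} = {v | MonomialRel Δ I b v} :=
    Set.ext fun v => ⟨hwb.symm.trans, hwb.trans⟩
  rw [hclass]
  by_cases hbI : monomial b 1 ∈ I
  -- Here `(I : x^b)` is the unit ideal, so `J = ⊤` imposes no condition on `m`.
  · refine hcell.monomialProj_mem_of_mem_sup hbin (J := ⊤) (fun g _ => ?_) (f := m) ?_
    · exact mem_elimIdeal_colon.2 (I.mul_mem_left _ hbI)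
    · rw [Ideal.map_top, sup_top_eq]
      trivial
  · obtain ⟨τ', hτ'⟩ := hcell.exists_isWitness hbin hbΔ hbI
    obtain ⟨J, hJle, hJ⟩ := hfin.exists_le_minimal ⟨b, τ', ha.of_le hab hτ', rfl⟩
    refine hcell.monomialProj_mem_of_mem_idealSaturation hbin (hJle.trans hτ'.2.ge) (f := m) ?_
    have := (Submodule.mem_iInf _).1 ((Submodule.mem_iInf _).1 hfJ J) hJ
    exact (Ideal.add_mem_iff_right _ (hsat J hi)).1 this
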